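/- All rings are commutative with unity. For a ring $A$ and an ideal $I$ of $A$, let $A\bowtie I:=\{(a,a+i)\mid a\in A,\ i\in I\}$, a subring of $A\times A$ (the amalgamated duplication of $A$ along $I$). For a maximal ideal $\mathfrak m$ of $A$, let $I_{\mathfrak m}=IA_{\mathfrak m}$ be the localization of $I$ at $\mathfrak m$. The weak global dimension $\mathrm{w.dim}(R)\in\{0,1,2,\dots,\infty\}$ of a ring $R$ is the supremum of the flat dimensions of all $R$-modules, and $R$ is semihereditary if every finitely generated ideal of $R$ is projective as an $R$-module. **Theorem.** Let $A$ be a ring and $I$ a proper ideal of $A$. Then: 1. $\mathrm{w.dim}(A\bowtie I)\le 1$ if and only if $\mathrm{w.dim}(A)\le 1$ and $I_{\mathfrak m}=0$ for every maximal ideal $\mathfrak m$ of $A$ with $I\subseteq\mathfrak m$. 2. Assume that $I$ is finitely generated. Then $A\bowtie I$ is semihereditary if and only if $A$ is semihereditary and $I_{\mathfrak m}=0$ for every maximal ideal $\mathfrak m$ of $A$ with $I\subseteq\mathfrak m$. -/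

import Mathlib

universe u

/-- The amalgamated duplication `A ⋈ I = {(a, a + i) | a ∈ A, i ∈ I}` of a commutative ring `A`
along an ideal `I`, as a subring of `A × A`. -/
def amalgamatedDuplication {A : Type u} [CommRing A] (I : Ideal A) : Subring (A × A) where
  carrier := {x | ∃ a : A, ∃ i ∈ I, x = (a, a + i)}
  mul_mem' := by
    rintro _ _ ⟨a, i, hi, rfl⟩ ⟨b, j, hj, rfl⟩
    refine ⟨a * b, a * j + i * (b + j),
      I.add_mem (I.mul_mem_left _ hj) (I.mul_mem_right _ hi), ?_⟩
    ext
    · rfl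
    · simp only [Prod.snd_mul]
      ring
  one_mem' := ⟨1, 0, I.zero_mem, by ext <;> simp⟩
  add_mem' := by
    rintro _ _ ⟨a, i, hi, rfl⟩ ⟨b, j, hj, rfl⟩
    refine ⟨a + b, i + j, I.add_mem hi hj, ?_⟩
    ext
    · rfl
    · simp only [Prod.snd_add]
      ring
  zero_mem' := ⟨0, 0, I.zero_mem, by ext <;> simp⟩
  neg_mem' := by
    rintro _ ⟨a, i, hi, rfl⟩
    refine ⟨-a, -i, I.neg_mem hi, ?_⟩
    ext
    · rfl
    · simp only [Prod.snd_neg]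
      ring

/-- `M` has a flat resolution `0 → Fₙ → ⋯ → F₁ → F₀ → M → 0` of length at most `n`.
The resolution is built one step at a time: `M` is flat if `n = 0`, and for `n + 1` there is a
surjection from a flat module onto `M` whose kernel has a flat resolution of length at most `n`. -/
def HasFlatResolutionLE (R : Type u) [CommRing R] :
    ℕ → ∀ (M : Type u) [AddCommGroup M] [Module R M], Prop
  | 0, M, _, _ => Module.Flat R M
  | n + 1, M, _, _ => ∃ (F : ModuleCat.{u} R) (f : F →ₗ[R] M),
      Module.Flat R F ∧ Function.Surjective f ∧ HasFlatResolutionLE R n (LinearMap.ker f)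

/-- The flat dimension of a module: the least length of a flat resolution, and `⊤` if there is
no flat resolution of finite length. -/
noncomputable def flatDimension (R : Type u) [CommRing R]
    (M : Type u) [AddCommGroup M] [Module R M] : ℕ∞ :=
  ⨅ (n : ℕ) (_ : HasFlatResolutionLE R n M), (n : ℕ∞)

/-- The weak global dimension of a ring: the supremum of the flat dimensions of its modules. -/
noncomputable def weakGlobalDimension (R : Type u) [CommRing R] : ℕ∞ :=
  ⨆ M : ModuleCat.{u} R, flatDimension R M

/-- A ring is semihereditary if every finitely generated ideal is projective. -/
def IsSemihereditary (R : Type u) [CommRing R] : Prop :=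
  ∀ J : Ideal R, J.FG → Module.Projective R J

/-! Both ring conditions reduce to statements about elements. Weak dimension at most one means
`LocallyNoZeroDivisors` and `LocallyTotalDvd`; semihereditary means `AnnihilatorsIdempotent` and
`LocallyTotalDvd` (`forall_ideal_flat_iff`, `isSemihereditary_iff`). Local vanishing of `I` means
that every `i ∈ I` is fixed by some `e ∈ I`.

The element conditions descend to `A`, a retract of `A ⋈ I`, and the relation `(i, 0) * (0, i) = 0`
produces `e`. Conversely, if `e` fixes the differences of coordinates of the given pairs, witnesses
found in each coordinate are patched by `glue`. -/

/-! ### Weak dimension and flatness of ideals. -/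

section Flatness

variable {R : Type u} [CommRing R]

/-- The kernel of a surjection between flat modules is flat. -/
theorem Module.Flat.of_exact_of_flat {N M P : Type u} [AddCommGroup N] [AddCommGroup M]
    [AddCommGroup P] [Module R N] [Module R M] [Module R P] {f : N →ₗ[R] M} {g : M →ₗ[R] P}
    (hf : Function.Injective f) (hfg : Function.Exact f g) (hg : Function.Surjective g)
    [Module.Flat R M] [Module.Flat R P] : Module.Flat R N := by
  rw [Module.Flat.iff_lTensor_injective']
  intro J
  -- Flatness of `P` keeps the sequence injective on the left after tensoring with `J`.
  have h1 : Function.Injective (f.rTensor J) := by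
    have := LinearMap.lTensor_injective_of_exact_of_flat g hg f hf hfg J
    rwa [LinearMap.lTensor_inj_iff_rTensor_inj] at this
  have h2 := Module.Flat.lTensor_preserves_injective_linearMap (M := M) J.subtype
    J.injective_subtype
  refine Function.Injective.of_comp (f := f.rTensor R) ?_
  rw [← LinearMap.coe_comp, LinearMap.rTensor_comp_lTensor, ← LinearMap.lTensor_comp_rTensor,
    LinearMap.coe_comp]
  exact h2.comp h1

theorem Module.Flat.prod_of_flat {M N : Type u} [AddCommGroup M] [AddCommGroup N]
    [Module R M] [Module R N] [Module.Flat R M] [Module.Flat R N] : Module.Flat R (M × N) := by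
  rw [Module.Flat.iff_lTensor_injective']
  intro J
  rw [injective_iff_map_eq_zero]
  intro x hx
  have h1 : (LinearMap.fst R M N).rTensor J x = 0 := by
    refine (injective_iff_map_eq_zero _).mp
      (Module.Flat.lTensor_preserves_injective_linearMap (M := M) J.subtype
        J.injective_subtype) _ ?_
    rw [← LinearMap.comp_apply, LinearMap.lTensor_comp_rTensor, ← LinearMap.rTensor_comp_lTensor,
      LinearMap.comp_apply, hx, map_zero]
  have h2 : (LinearMap.snd R M N).rTensor J x = 0 := by
    refine (injective_iff_map_eq_zero _).mp
      (Module.Flat.lTensor_preserves_injective_linearMap (M := N) J.subtype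
        J.injective_subtype) _ ?_
    rw [← LinearMap.comp_apply, LinearMap.lTensor_comp_rTensor, ← LinearMap.rTensor_comp_lTensor,
      LinearMap.comp_apply, hx, map_zero]
  have hid : (LinearMap.inl R M N) ∘ₗ (LinearMap.fst R M N) +
      (LinearMap.inr R M N) ∘ₗ (LinearMap.snd R M N) = LinearMap.id := by
    ext <;> simp
  have := LinearMap.congr_fun (congrArg (LinearMap.rTensor J) hid) x
  rwa [LinearMap.rTensor_add, LinearMap.rTensor_comp, LinearMap.rTensor_comp, LinearMap.add_apply,
    LinearMap.comp_apply, LinearMap.comp_apply, h1, h2, map_zero, map_zero, add_zero,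
    LinearMap.rTensor_id, LinearMap.id_apply, eq_comm] at this

/-- If all finitely generated ideals are flat, then submodules of flat modules are flat. -/
theorem Module.Flat.of_injective_of_forall_ideal_flat
    (h : ∀ J : Ideal R, J.FG → Module.Flat R J) {N M : Type u} [AddCommGroup N] [AddCommGroup M]
    [Module R N] [Module R M] [Module.Flat R M] (f : N →ₗ[R] M) (hf : Function.Injective f) :
    Module.Flat R N := by
  rw [Module.Flat.iff_lTensor_injective]
  intro J hJ
  have := h J hJ
  have h1 := Module.Flat.rTensor_preserves_injective_linearMap (M := J) f hf
  have h2 := Module.Flat.lTensor_preserves_injective_linearMap (M := M) J.subtype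
    J.injective_subtype
  refine Function.Injective.of_comp (f := f.rTensor R) ?_
  rw [← LinearMap.coe_comp, LinearMap.rTensor_comp_lTensor, ← LinearMap.lTensor_comp_rTensor,
    LinearMap.coe_comp]
  exact h2.comp h1

theorem HasFlatResolutionLE.succ {n : ℕ} : ∀ {M : Type u} [AddCommGroup M] [Module R M],
    HasFlatResolutionLE R n M → HasFlatResolutionLE R (n + 1) M := by
  induction n with
  | zero =>
    intro M _ _ hM
    refine ⟨ModuleCat.of R M, LinearMap.id, hM, Function.surjective_id, ?_⟩
    have : Subsingleton (LinearMap.ker (LinearMap.id : M →ₗ[R] M)) := by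
      rw [LinearMap.ker_id]; infer_instance
    exact (inferInstance : Module.Flat R (LinearMap.ker (LinearMap.id : M →ₗ[R] M)))
  | succ n ih =>
    rintro M _ _ ⟨F, f, hF, hf, hK⟩
    exact ⟨F, f, hF, hf, ih hK⟩

theorem HasFlatResolutionLE.mono {n m : ℕ} (hnm : n ≤ m) {M : Type u} [AddCommGroup M]
    [Module R M] (h : HasFlatResolutionLE R n M) : HasFlatResolutionLE R m M := by
  induction hnm with
  | refl => exact h
  | step _ ih => exact ih.succ

theorem flatDimension_le_iff {n : ℕ} {M : Type u} [AddCommGroup M] [Module R M] :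
    flatDimension R M ≤ n ↔ HasFlatResolutionLE R n M := by
  refine ⟨fun h => ?_, fun h => iInf₂_le n h⟩
  by_contra hn
  have : ((n + 1 : ℕ) : ℕ∞) ≤ flatDimension R M := by
    refine le_iInf₂ fun k hk => ?_
    have : ¬ k ≤ n := fun hkn => hn (hk.mono hkn)
    exact_mod_cast Nat.succ_le_of_lt (not_le.mp this)
  have := this.trans h
  norm_cast at this
  omega

/-- Schanuel's argument: lifting `1` to `x : F` gives an exact sequence `0 → J → ker f × R → F → 0`
whose last two terms are flat. -/
theorem HasFlatResolutionLE.flat_ideal {J : Ideal R} (h : HasFlatResolutionLE R 1 (R ⧸ J)) :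
    Module.Flat R J := by
  obtain ⟨F, f, hF, hf, hK⟩ := h
  have hK : Module.Flat R (LinearMap.ker f) := hK
  obtain ⟨x, hx⟩ := hf 1
  have key (r : R) : f (r • x) = Ideal.Quotient.mk J r := by
    rw [map_smul, hx, Algebra.smul_def, mul_one]; rfl
  let g : (LinearMap.ker f × R) →ₗ[R] F :=
    (LinearMap.ker f).subtype.coprod (LinearMap.toSpanSingleton R F x)
  let i : J →ₗ[R] LinearMap.ker f × R :=
    LinearMap.prod (LinearMap.codRestrict _ (-(LinearMap.toSpanSingleton R F x ∘ₗ J.subtype))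
      fun j => by
        simp [key, Ideal.Quotient.eq_zero_iff_mem]) J.subtype
  have : Module.Flat R (LinearMap.ker f × R) := Module.Flat.prod_of_flat
  refine Module.Flat.of_exact_of_flat (f := i) (g := g) ?_ ?_ ?_
  · intro a b hab
    exact Subtype.ext (congrArg Prod.snd hab)
  · rintro ⟨⟨k, hk⟩, r⟩
    constructor
    · intro h
      have h : k + r • x = 0 := h
      have hr : r ∈ J := by
        rw [← Ideal.Quotient.eq_zero_iff_mem, ← key, eq_neg_of_add_eq_zero_right h, map_neg,
          LinearMap.mem_ker.mp hk, neg_zero]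
      exact ⟨⟨r, hr⟩, Prod.ext (Subtype.ext (eq_neg_of_add_eq_zero_left h).symm) rfl⟩
    · rintro ⟨j, hj⟩
      rw [← hj]
      change -((j : R) • x) + (j : R) • x = 0
      exact neg_add_cancel _
  · intro y
    obtain ⟨r, hr⟩ := Ideal.Quotient.mk_surjective (f y)
    refine ⟨⟨⟨y - r • x, ?_⟩, r⟩, sub_add_cancel _ _⟩
    rw [LinearMap.mem_ker, map_sub, key, hr, sub_self]

/-- A ring has weak global dimension at most one iff its finitely generated ideals are flat. -/
theorem weakGlobalDimension_le_one_iff :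
    weakGlobalDimension R ≤ 1 ↔ ∀ J : Ideal R, J.FG → Module.Flat R J := by
  constructor
  · intro h J _
    have h1 := (le_iSup (fun M : ModuleCat.{u} R => flatDimension R M)
      (ModuleCat.of R (R ⧸ J))).trans h
    exact HasFlatResolutionLE.flat_ideal (flatDimension_le_iff (n := 1).mp (by exact_mod_cast h1))
  · intro h
    refine iSup_le fun M => ?_
    have : HasFlatResolutionLE R 1 M := by
      refine ⟨ModuleCat.of R (M →₀ R), Finsupp.linearCombination R id,
        (inferInstance : Module.Flat R (M →₀ R)),
        Finsupp.linearCombination_id_surjective R M, ?_⟩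
      exact Module.Flat.of_injective_of_forall_ideal_flat h
        (LinearMap.ker (Finsupp.linearCombination R (id : M → M))).subtype
        (Submodule.injective_subtype _)
    exact_mod_cast flatDimension_le_iff (n := 1).mpr this

end Flatness

/-! ### Elementwise criteria for flat and projective ideals. -/

section Arithmetical

variable {R S : Type*} [CommRing R] [CommRing S]

/-- Every two elements are, locally on the spectrum, comparable for divisibility. -/
def LocallyTotalDvd (R : Type*) [CommRing R] : Prop :=
  ∀ a b : R, ∃ s : R, b ∣ s * a ∧ a ∣ (1 - s) * b

/-- Whenever `a * b = 0`, locally on the spectrum `a` or `b` vanishes. -/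
def LocallyNoZeroDivisors (R : Type*) [CommRing R] : Prop :=
  ∀ a b : R, a * b = 0 → ∃ c, c * a = 0 ∧ c * b = b

/-- Annihilators of elements are generated by idempotents. -/
def AnnihilatorsIdempotent (R : Type*) [CommRing R] : Prop :=
  ∀ a : R, ∃ c, c * a = 0 ∧ ∀ b, a * b = 0 → c * b = b

theorem LocallyTotalDvd.of_retract (f : R →+* S) (g : S →+* R) (h : g.comp f = RingHom.id R)
    (hS : LocallyTotalDvd S) : LocallyTotalDvd R := by
  intro a b
  have hgf (x : R) : g (f x) = x := RingHom.congr_fun h x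
  obtain ⟨s, h1, h2⟩ := hS (f a) (f b)
  refine ⟨g s, ?_, ?_⟩
  · simpa [hgf] using map_dvd g h1
  · simpa [hgf] using map_dvd g h2

theorem LocallyNoZeroDivisors.of_retract (f : R →+* S) (g : S →+* R)
    (h : g.comp f = RingHom.id R) (hS : LocallyNoZeroDivisors S) : LocallyNoZeroDivisors R := by
  intro a b hab
  have hgf (x : R) : g (f x) = x := RingHom.congr_fun h x
  obtain ⟨c, h1, h2⟩ := hS (f a) (f b) (by rw [← map_mul, hab, map_zero])
  refine ⟨g c, ?_, ?_⟩
  · simpa [hgf] using congrArg g h1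
  · simpa [hgf] using congrArg g h2

theorem AnnihilatorsIdempotent.of_retract (f : R →+* S) (g : S →+* R)
    (h : g.comp f = RingHom.id R) (hS : AnnihilatorsIdempotent S) : AnnihilatorsIdempotent R := by
  intro a
  have hgf (x : R) : g (f x) = x := RingHom.congr_fun h x
  obtain ⟨c, h1, h2⟩ := hS (f a)
  refine ⟨g c, by simpa [hgf] using congrArg g h1, fun b hab => ?_⟩
  simpa [hgf] using congrArg g (h2 (f b) (by rw [← map_mul, hab, map_zero]))

/-- The equational criterion is applied to the relation `b • a - a • b = 0` in the ideal `(a, b)`.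
-/
theorem LocallyTotalDvd.of_flat
    (h : ∀ J : Ideal R, J.FG → Module.Flat R J) : LocallyTotalDvd R := by
  intro a b
  let J : Ideal R := Ideal.span {a, b}
  have := h J (Submodule.fg_span (by simp))
  have haJ : a ∈ J := Ideal.subset_span (by simp)
  have hbJ : b ∈ J := Ideal.subset_span (by simp)
  obtain ⟨k, c, y, hy, hc⟩ := Module.Flat.isTrivialRelation_of_sum_smul_eq_zero
    (R := R) (M := J) (f := ![b, -a]) (x := ![⟨a, haJ⟩, ⟨b, hbJ⟩])
    (by ext; simp [mul_comm])
  have hpq (j : Fin k) : ∃ p q : R, p * a + q * b = y j := Ideal.mem_span_pair.mp (y j).2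
  choose p q hpq using hpq
  have ha : a = ∑ j, c 0 j * (p j * a + q j * b) := by
    simpa [hpq] using congrArg Subtype.val (hy 0)
  have hc (j : Fin k) : b * c 0 j = a * c 1 j := by
    have := hc j
    simp only [Fin.sum_univ_two, Matrix.cons_val_zero, Matrix.cons_val_one] at this
    linear_combination this
  refine ⟨1 - ∑ j, c 0 j * p j, ⟨∑ j, c 0 j * q j, ?_⟩, ⟨∑ j, c 1 j * p j, ?_⟩⟩
  · have : a = (∑ j, c 0 j * p j) * a + (∑ j, c 0 j * q j) * b := by
      conv_lhs => rw [ha]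
      rw [Finset.sum_mul, Finset.sum_mul, ← Finset.sum_add_distrib]
      exact Finset.sum_congr rfl fun j _ => by ring
    linear_combination this
  · rw [sub_sub_cancel, Finset.sum_mul, Finset.mul_sum]
    exact Finset.sum_congr rfl fun j _ => by linear_combination p j * hc j

/-- Trivializing the relation `b • a = 0` in `(a)` yields an element that fixes `a` and kills `b`;
its complement is the witness. -/
theorem LocallyNoZeroDivisors.of_flat
    (h : ∀ J : Ideal R, J.FG → Module.Flat R J) : LocallyNoZeroDivisors R := by
  intro a b hab
  let J : Ideal R := Ideal.span {a}
  have := h J (Submodule.fg_span (by simp))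
  have haJ : a ∈ J := Ideal.mem_span_singleton_self a
  obtain ⟨k, c, y, hy, hc⟩ := Module.Flat.isTrivialRelation_of_sum_smul_eq_zero
    (R := R) (M := J) (ι := Unit) (f := fun _ => b) (x := fun _ => ⟨a, haJ⟩)
    (by ext; simpa [mul_comm] using hab)
  have hp (j : Fin k) : ∃ p : R, p * a = y j := Ideal.mem_span_singleton'.mp (y j).2
  choose p hp using hp
  have ha : a = (∑ j, c () j * p j) * a := by
    rw [Finset.sum_mul]
    simpa [← hp, mul_assoc] using congrArg Subtype.val (hy ())
  have hb : (∑ j, c () j * p j) * b = 0 := by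
    rw [Finset.sum_mul]
    refine Finset.sum_eq_zero fun j _ => ?_
    have : b * c () j = 0 := by simpa using hc j
    linear_combination p j * this
  exact ⟨1 - ∑ j, c () j * p j, by linear_combination ha, by linear_combination -hb⟩

theorem LocallyNoZeroDivisors.flat_span_singleton (h : LocallyNoZeroDivisors R) (a : R) :
    Module.Flat R (Ideal.span {a}) := by
  refine Module.Flat.of_forall_isTrivialRelation fun {l f x} hfx => ?_
  have hr (i : Fin l) : ∃ r : R, r * a = x i := Ideal.mem_span_singleton'.mp (x i).2
  choose r hr using hr
  obtain ⟨c, hca, hcb⟩ := h a (∑ i, f i * r i) (by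
    have : ∑ i, f i * (x i : R) = 0 := by simpa using congrArg Subtype.val hfx
    rw [← this, Finset.mul_sum]
    exact Finset.sum_congr rfl fun i _ => by rw [← hr]; ring)
  -- Since `c` kills `a`, replacing `r i` by `(1 - c) * r i` leaves `x i` unchanged; since `c` fixes
  -- `∑ f i * r i`, the new coefficients satisfy the relation in `R`.
  refine ⟨1, fun i _ => (1 - c) * r i, fun _ => ⟨a, Ideal.mem_span_singleton_self a⟩,
    fun i => ?_, fun _ => ?_⟩
  · ext
    simp only [Finset.univ_unique, Finset.sum_const, Finset.card_singleton, one_smul,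
      SetLike.mk_smul_mk, smul_eq_mul]
    linear_combination -hr i + r i * hca
  · have : ∑ i, f i * ((1 - c) * r i) = (1 - c) * ∑ i, f i * r i := by
      rw [Finset.mul_sum]
      exact Finset.sum_congr rfl fun i _ => by ring
    rw [this]
    linear_combination -hcb

/-- A section `σ` of `R → (a)` gives `σ x` fixing `a` and killed by every annihilator of `a`. -/
theorem AnnihilatorsIdempotent.of_projective
    (h : ∀ J : Ideal R, J.FG → Module.Projective R J) : AnnihilatorsIdempotent R := by
  intro a
  let J : Ideal R := Ideal.span {a}
  have := h J (Submodule.fg_span (by simp))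
  let x : J := ⟨a, Ideal.mem_span_singleton_self a⟩
  obtain ⟨σ, hσ⟩ := LinearMap.exists_rightInverse_of_surjective
    (LinearMap.toSpanSingleton R J x) (LinearMap.range_eq_top.mpr fun y => by
      obtain ⟨r, hr⟩ := Ideal.mem_span_singleton'.mp y.2
      exact ⟨r, Subtype.ext hr⟩)
  have hx : σ x * a = a := congrArg Subtype.val (LinearMap.congr_fun hσ x)
  refine ⟨1 - σ x, by linear_combination -hx, fun b hab => ?_⟩
  have hbx : b • x = 0 := Subtype.ext (by simpa [x, mul_comm] using hab)
  have : b * σ x = 0 := by rw [← smul_eq_mul, ← map_smul, hbx, map_zero]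
  linear_combination -this

theorem AnnihilatorsIdempotent.projective_span_singleton (h : AnnihilatorsIdempotent R) (a : R) :
    Module.Projective R (Ideal.span {a}) := by
  obtain ⟨c, hca, hc⟩ := h a
  have hr (x : Ideal.span {a}) : ∃ r : R, r * a = x := Ideal.mem_span_singleton'.mp x.2
  choose r hr using hr
  -- Makes the section well defined: `(1 - c) * r` depends only on `r * a`.
  have huniq {s t : R} (hst : s * a = t * a) : (1 - c) * s = (1 - c) * t := by
    linear_combination -hc (s - t) (by linear_combination hst)
  let σ : Ideal.span {a} →ₗ[R] R :=
    { toFun := fun x => (1 - c) * r x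
      map_add' := fun x y => by
        rw [← mul_add]
        exact huniq (by rw [add_mul, hr, hr, hr]; rfl)
      map_smul' := fun s x => by
        rw [RingHom.id_apply, smul_eq_mul, mul_left_comm]
        exact huniq (by rw [mul_assoc, hr, hr]; rfl) }
  refine Module.Projective.of_split σ
    (LinearMap.toSpanSingleton R _ ⟨a, Ideal.mem_span_singleton_self a⟩) ?_
  ext x
  change (1 - c) * r x * a = x
  linear_combination hr x - r x * hca

/-- A partition of unity adapted to finitely many elements: on the locus where `t a` is
invertible, `a` divides all of them. -/
theorem LocallyTotalDvd.exists_partition (h : LocallyTotalDvd R) {s : Finset R}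
    (hs : s.Nonempty) :
    ∃ t : R → R, ∑ a ∈ s, t a = 1 ∧ ∀ a ∈ s, ∀ b ∈ s, a ∣ t a * b := by
  classical
  induction hs using Finset.Nonempty.cons_induction with
  | singleton a => exact ⟨fun _ => 1, by simp, by simp⟩
  | cons c s hc hs ih =>
    obtain ⟨t, ht1, ht⟩ := ih
    choose w hw1 hw2 using fun a => h a c
    have hne {a : R} (ha : a ∈ s) : a ≠ c := fun hac => hc (hac ▸ ha)
    -- Each old weight `t a` is split: the share `w a`, where `c` divides `a`, passes to `c`; the
    -- share `1 - w a`, where `a` divides `c`, stays with `a`.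
    refine ⟨fun a => if a = c then ∑ b ∈ s, t b * w b else t a * (1 - w a), ?_, ?_⟩
    · have hsum : ∑ a ∈ s, (if a = c then ∑ b ∈ s, t b * w b else t a * (1 - w a)) =
          ∑ a ∈ s, t a * (1 - w a) :=
        Finset.sum_congr rfl fun a ha => if_neg (hne ha)
      rw [Finset.sum_cons, if_pos rfl, hsum, ← Finset.sum_add_distrib]
      simpa [← mul_add] using ht1
    · intro a ha b hb
      rw [Finset.mem_cons] at ha hb
      beta_reduce
      split_ifs with hac
      · subst hac
        rcases hb with rfl | hb
        · exact dvd_mul_left _ _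
        · rw [Finset.sum_mul]
          refine Finset.dvd_sum fun d hd => ?_
          obtain ⟨r, hr⟩ := ht d hd b hb
          obtain ⟨q, hq⟩ := hw1 d
          exact ⟨q * r, by linear_combination w d * hr + r * hq⟩
      · have ha := ha.resolve_left hac
        rcases hb with rfl | hb
        · exact (hw2 a).trans ⟨t a, by ring⟩
        · exact (ht a ha b hb).trans ⟨1 - w a, by ring⟩

/-- If `J` is finitely generated, it is a direct factor of a direct sum of principal ideals. -/
theorem LocallyTotalDvd.exists_retract (h : LocallyTotalDvd R) {J : Ideal R} (hJ : J.FG) :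
    ∃ (s : Finset R) (i : J →ₗ[R] Π₀ a : s, Ideal.span {(a : R)})
      (p : (Π₀ a : s, Ideal.span {(a : R)}) →ₗ[R] J), p ∘ₗ i = LinearMap.id := by
  classical
  obtain ⟨s, rfl, hs⟩ : ∃ s : Finset R, Ideal.span (s : Set R) = J ∧ s.Nonempty := by
    obtain ⟨s, hs⟩ := hJ
    -- Adjoining `0` guarantees the nonempty generating set that a partition of unity needs.
    refine ⟨insert 0 s, ?_, Finset.insert_nonempty _ _⟩
    rw [Finset.coe_insert, ← hs]
    exact Submodule.span_insert_zero
  obtain ⟨t, ht1, ht⟩ := h.exists_partition hs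
  have hle (a : s) : Ideal.span {(a : R)} ≤ Ideal.span (s : Set R) :=
    Ideal.span_mono (Set.singleton_subset_iff.mpr a.2)
  have hmem (a : s) (x : Ideal.span (s : Set R)) : t a * x ∈ Ideal.span {(a : R)} := by
    have : Ideal.span (s : Set R) ≤
        Submodule.comap (LinearMap.mulLeft R (t a)) (Ideal.span {(a : R)}) :=
      Submodule.span_le.mpr fun b hb => Ideal.mem_span_singleton.mpr (ht a a.2 b hb)
    exact this x.2
  let m (a : s) : Ideal.span (s : Set R) →ₗ[R] Ideal.span {(a : R)} :=
    ((LinearMap.mulLeft R (t a)).comp (Submodule.subtype _)).codRestrict _ (hmem a)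
  refine ⟨s, ∑ a : s, (DFinsupp.lsingle a).comp (m a),
    DFinsupp.lsum ℕ fun a => Submodule.inclusion (hle a), ?_⟩
  ext x
  have hsum (a : s) : DFinsupp.lsum ℕ (fun a : s => Submodule.inclusion (hle a))
      (DFinsupp.lsingle (R := R) a (m a x)) = Submodule.inclusion (hle a) (m a x) :=
    DFinsupp.sumAddHom_single (fun a : s => (Submodule.inclusion (hle a)).toAddMonoidHom) a (m a x)
  simp only [LinearMap.comp_apply, LinearMap.sum_apply, map_sum, hsum, LinearMap.id_apply,
    Submodule.coe_sum]
  change ∑ a : s, t a * (x : R) = x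
  rw [← Finset.sum_mul, Finset.sum_coe_sort s t, ht1, one_mul]

theorem forall_ideal_flat_iff : (∀ J : Ideal R, J.FG → Module.Flat R J) ↔
    LocallyNoZeroDivisors R ∧ LocallyTotalDvd R := by
  refine ⟨fun h => ⟨.of_flat h, .of_flat h⟩, fun ⟨h1, h2⟩ J hJ => ?_⟩
  obtain ⟨s, i, p, hpi⟩ := h2.exists_retract hJ
  have (a : s) := h1.flat_span_singleton (a : R)
  have := (Module.Flat.dfinsupp_iff (R := R) (M := fun a : s => Ideal.span {(a : R)})).mpr this
  exact Module.Flat.of_retract i p hpi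

theorem isSemihereditary_iff {R : Type u} [CommRing R] : IsSemihereditary R ↔
    AnnihilatorsIdempotent R ∧ LocallyTotalDvd R := by
  refine ⟨fun h => ⟨.of_projective h, .of_flat fun J hJ => ?_⟩, fun ⟨h1, h2⟩ J hJ => ?_⟩
  · have := h J hJ
    infer_instance
  · obtain ⟨s, i, p, hpi⟩ := h2.exists_retract hJ
    have (a : s) := h1.projective_span_singleton (a : R)
    have : Module.Projective R (Π₀ a : s, Ideal.span {(a : R)}) :=
      Module.Projective.directSum_iff.mpr this
    exact Module.Projective.of_split i p hpi

theorem AnnihilatorsIdempotent.locallyNoZeroDivisors (h : AnnihilatorsIdempotent R) :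
    LocallyNoZeroDivisors R := fun a b hab =>
  let ⟨c, hca, hc⟩ := h a
  ⟨c, hca, hc b hab⟩

end Arithmetical

/-! ### Ideals vanishing locally on their zero locus. -/

section Pure

variable {A : Type u} [CommRing A] {I : Ideal A}

/-- An ideal vanishes locally on its zero locus iff each of its elements `i` satisfies
`e * i = i` for some `e` in the ideal. -/
theorem map_localization_eq_bot_iff :
    (∀ (m : Ideal A) [m.IsMaximal], I ≤ m →
      I.map (algebraMap A (Localization.AtPrime m)) = ⊥) ↔ ∀ i ∈ I, ∃ e ∈ I, e * i = i := by
  constructor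
  · intro h i hi
    -- A maximal ideal containing this sum contains `I`, so `i` dies in its localization and has an
    -- annihilator outside it.
    have htop : I ⊔ Ideal.span {x | x * i = 0} = ⊤ := by
      by_contra hne
      obtain ⟨m, hm, hle⟩ := Ideal.exists_le_maximal _ hne
      have h0 := (Ideal.map_eq_bot_iff_le_ker _).mp (h m (le_sup_left.trans hle)) hi
      obtain ⟨x, hx⟩ := (IsLocalization.map_eq_zero_iff m.primeCompl _ i).mp
        (RingHom.mem_ker.mp h0)
      exact x.2 (hle (Ideal.mem_sup_right (Ideal.subset_span hx)))
    obtain ⟨e, he, x, hx, hex⟩ := Submodule.mem_sup.mp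
      (htop ▸ Submodule.mem_top : (1 : A) ∈ I ⊔ Ideal.span {x | x * i = 0})
    have hxi : x * i = 0 := by
      clear hex
      induction hx using Submodule.span_induction with
      | mem x hx => exact hx
      | zero => exact zero_mul i
      | add x y _ _ hx hy => linear_combination hx + hy
      | smul r x _ hx => linear_combination r * hx
    exact ⟨e, he, by linear_combination i * hex - hxi⟩
  · intro h m _ hm
    rw [Ideal.map_eq_bot_iff_le_ker]
    intro i hi
    obtain ⟨e, he, hei⟩ := h i hi
    rw [RingHom.mem_ker, IsLocalization.map_eq_zero_iff m.primeCompl]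
    refine ⟨⟨1 - e, fun h1 => ?_⟩, by linear_combination -hei⟩
    exact (Ideal.ne_top_iff_one m).mp (Ideal.IsMaximal.ne_top ‹_›)
      (by simpa using m.add_mem h1 (hm he))

theorem exists_mul_eq_of_finset (h : ∀ i ∈ I, ∃ e ∈ I, e * i = i) (s : Finset A)
    (hs : (s : Set A) ⊆ I) : ∃ e ∈ I, ∀ i ∈ s, e * i = i := by
  classical
  induction s using Finset.induction_on with
  | empty => exact ⟨0, I.zero_mem, by simp⟩
  | insert a s _ ih =>
    rw [Finset.coe_insert, Set.insert_subset_iff] at hs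
    obtain ⟨e, he, hes⟩ := ih hs.2
    obtain ⟨f, hf, hfa⟩ := h a hs.1
    -- This is `1 - (1 - e) * (1 - f)`, which fixes whatever `e` or `f` fixes.
    refine ⟨e + f - e * f, I.sub_mem (I.add_mem he hf) (I.mul_mem_left _ hf), fun i hi => ?_⟩
    rcases Finset.mem_insert.mp hi with rfl | hi
    · linear_combination (1 - e) * hfa
    · linear_combination (1 - f) * hes i hi

theorem exists_mul_eq_of_fg (h : ∀ i ∈ I, ∃ e ∈ I, e * i = i) (hI : I.FG) :
    ∃ e ∈ I, ∀ i ∈ I, e * i = i := by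
  obtain ⟨s, rfl⟩ := hI
  obtain ⟨e, he, hes⟩ := exists_mul_eq_of_finset h s Submodule.subset_span
  refine ⟨e, he, fun i hi => ?_⟩
  induction hi using Submodule.span_induction with
  | mem x hx => exact hes x hx
  | zero => exact mul_zero e
  | add x y _ _ hx hy => rw [mul_add, hx, hy]
  | smul r x _ hx => rw [smul_eq_mul, mul_left_comm, hx]

end Pure

/-! ### Transfer between `A` and `A ⋈ I`. -/

namespace amalgamatedDuplication

variable {A : Type u} [CommRing A] {I : Ideal A}

theorem mk_mem {x y : A} (h : y - x ∈ I) : (x, y) ∈ amalgamatedDuplication I :=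
  ⟨x, y - x, h, by simp⟩

theorem sub_mem (x : amalgamatedDuplication I) : x.1.2 - x.1.1 ∈ I := by
  obtain ⟨_, a, i, hi, rfl⟩ := x
  simpa using hi

variable (I) in
/-- The diagonal embedding `A → A ⋈ I`. -/
def diagonal : A →+* amalgamatedDuplication I :=
  ((RingHom.id A).prod (RingHom.id A)).codRestrict _ fun a =>
    mk_mem (by simp)

variable (I) in
/-- The first projection `A ⋈ I → A`. -/
def fst : amalgamatedDuplication I →+* A :=
  (RingHom.fst A A).comp (amalgamatedDuplication I).subtype

theorem fst_comp_diagonal : (fst I).comp (diagonal I) = RingHom.id A := rfl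

/-- The ring element that is `x.1` where `e = 0` and the pair `x` where `e = 1`. -/
def glue {e : A} (he : e ∈ I) (x : A × A) : amalgamatedDuplication I :=
  ⟨(x.1, (1 - e) * x.1 + e * x.2), mk_mem (by
    have : (1 - e) * x.1 + e * x.2 - x.1 = (x.2 - x.1) * e := by ring
    rw [this]
    exact I.mul_mem_left _ he)⟩

theorem exists_mul_eq (h : LocallyNoZeroDivisors (amalgamatedDuplication I)) :
    ∀ i ∈ I, ∃ e ∈ I, e * i = i := by
  intro i hi
  obtain ⟨c, hc1, hc2⟩ := h ⟨(i, 0), mk_mem (by simpa using hi)⟩ ⟨(0, i), mk_mem (by simpa using hi)⟩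
    (Subtype.ext (by ext <;> simp))
  have h1 : c.1.1 * i = 0 := congrArg (fun z => z.1.1) hc1
  have h2 : c.1.2 * i = i := congrArg (fun z => z.1.2) hc2
  exact ⟨c.1.2 - c.1.1, sub_mem c, by linear_combination h2 - h1⟩

theorem exists_mul_sub_eq (h : ∀ i ∈ I, ∃ e ∈ I, e * i = i) (x y : amalgamatedDuplication I) :
    ∃ e ∈ I, e * (x.1.2 - x.1.1) = x.1.2 - x.1.1 ∧ e * (y.1.2 - y.1.1) = y.1.2 - y.1.1 := by
  classical
  obtain ⟨e, he, hs⟩ := exists_mul_eq_of_finset h {x.1.2 - x.1.1, y.1.2 - y.1.1} (by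
    simp [Set.insert_subset_iff, sub_mem])
  exact ⟨e, he, hs _ (by simp), hs _ (by simp)⟩

/-- Because `(1 - e)` kills the difference of coordinates, the second-coordinate identity is `1 - e`
times the equation for first coordinates plus `e` times the one for second coordinates. -/
theorem locallyNoZeroDivisors (hI : ∀ i ∈ I, ∃ e ∈ I, e * i = i)
    (h : LocallyNoZeroDivisors A) : LocallyNoZeroDivisors (amalgamatedDuplication I) := by
  intro x y hxy
  obtain ⟨e, he, hx, hy⟩ := exists_mul_sub_eq hI x y
  obtain ⟨c, hc1, hc2⟩ := h x.1.1 y.1.1 (congrArg (fun z => z.1.1) hxy)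
  obtain ⟨d, hd1, hd2⟩ := h x.1.2 y.1.2 (congrArg (fun z => z.1.2) hxy)
  refine ⟨glue he (c, d), Subtype.ext (Prod.ext hc1 ?_), Subtype.ext (Prod.ext hc2 ?_)⟩
  · change ((1 - e) * c + e * d) * x.1.2 = 0
    linear_combination (1 - e) * hc1 + e * hd1 - c * hx
  · change ((1 - e) * c + e * d) * y.1.2 = y.1.2
    linear_combination (1 - e) * hc2 + e * hd2 + (1 - c) * hy

/-- One `e` must serve all of `I`: the witness is chosen before the annihilating `y`. -/
theorem annihilatorsIdempotent (hI : ∃ e ∈ I, ∀ i ∈ I, e * i = i)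
    (h : AnnihilatorsIdempotent A) : AnnihilatorsIdempotent (amalgamatedDuplication I) := by
  intro x
  obtain ⟨e, he, hs⟩ := hI
  have hx := hs _ (sub_mem x)
  obtain ⟨c, hc1, hc⟩ := h x.1.1
  obtain ⟨d, hd1, hd⟩ := h x.1.2
  refine ⟨glue he (c, d), Subtype.ext (Prod.ext hc1 ?_), fun y hxy => ?_⟩
  · change ((1 - e) * c + e * d) * x.1.2 = 0
    linear_combination (1 - e) * hc1 + e * hd1 - c * hx
  · have hy := hs _ (sub_mem y)
    have hc2 := hc y.1.1 (congrArg (fun z => z.1.1) hxy)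
    have hd2 := hd y.1.2 (congrArg (fun z => z.1.2) hxy)
    refine Subtype.ext (Prod.ext hc2 ?_)
    change ((1 - e) * c + e * d) * y.1.2 = y.1.2
    linear_combination (1 - e) * hc2 + e * hd2 + (1 - c) * hy

theorem locallyTotalDvd (hI : ∀ i ∈ I, ∃ e ∈ I, e * i = i)
    (h : LocallyTotalDvd A) : LocallyTotalDvd (amalgamatedDuplication I) := by
  intro x y
  obtain ⟨e, he, hx, hy⟩ := exists_mul_sub_eq hI x y
  obtain ⟨s, ⟨p, hp⟩, ⟨q, hq⟩⟩ := h x.1.1 y.1.1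
  obtain ⟨t, ⟨p', hp'⟩, ⟨q', hq'⟩⟩ := h x.1.2 y.1.2
  refine ⟨glue he (s, t), ⟨glue he (p, p'), Subtype.ext (Prod.ext hp ?_)⟩,
    ⟨glue he (q, q'), Subtype.ext (Prod.ext hq ?_)⟩⟩
  · change ((1 - e) * s + e * t) * x.1.2 = y.1.2 * ((1 - e) * p + e * p')
    linear_combination (1 - e) * hp + e * hp' - s * hx + p * hy
  · change (1 - ((1 - e) * s + e * t)) * y.1.2 = x.1.2 * ((1 - e) * q + e * q')
    linear_combination (1 - e) * hq + e * hq' - (1 - s) * hy + q * hx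

end amalgamatedDuplication

open amalgamatedDuplication in
theorem theorem4p1 {A : Type u} [CommRing A] (I : Ideal A) (hI : I ≠ ⊤) :
    (weakGlobalDimension (amalgamatedDuplication I) ≤ 1 ↔
      weakGlobalDimension A ≤ 1 ∧
        ∀ (m : Ideal A) [m.IsMaximal], I ≤ m →
          I.map (algebraMap A (Localization.AtPrime m)) = ⊥) ∧
    (I.FG →
      (IsSemihereditary (amalgamatedDuplication I) ↔
        IsSemihereditary A ∧
          ∀ (m : Ideal A) [m.IsMaximal], I ≤ m →
            I.map (algebraMap A (Localization.AtPrime m)) = ⊥)) := by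
  rw [map_localization_eq_bot_iff, weakGlobalDimension_le_one_iff, weakGlobalDimension_le_one_iff,
    forall_ideal_flat_iff, forall_ideal_flat_iff, isSemihereditary_iff, isSemihereditary_iff]
  refine ⟨⟨fun ⟨h1, h2⟩ => ?_, fun ⟨⟨h1, h2⟩, h3⟩ => ?_⟩,
    fun hfg => ⟨fun ⟨h1, h2⟩ => ?_, fun ⟨⟨h1, h2⟩, h3⟩ => ?_⟩⟩
  · exact ⟨⟨h1.of_retract _ _ fst_comp_diagonal, h2.of_retract _ _ fst_comp_diagonal⟩,
      exists_mul_eq h1⟩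
  · exact ⟨locallyNoZeroDivisors h3 h1, locallyTotalDvd h3 h2⟩
  · exact ⟨⟨h1.of_retract _ _ fst_comp_diagonal, h2.of_retract _ _ fst_comp_diagonal⟩,
      exists_mul_eq h1.locallyNoZeroDivisors⟩
  · exact ⟨annihilatorsIdempotent (exists_mul_eq_of_fg h3 hfg) h1, locallyTotalDvd h3 h2⟩
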